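/- All spaces are compact Hausdorff. A \emph{retraction} is a continuous map $f\colon Y\to X$ such that $f\circ j=\operatorname{id}_X$ for some continuous $j\colon X\to Y$; in this case $X$ is called a \emph{retract} of $Y$. A \emph{retractive inverse sequence} is an inverse system $(K_\alpha, r^\beta_\alpha)_{\alpha\le\beta<\delta}$ indexed by an ordinal $\delta$, in which every bonding map $r^\beta_\alpha\colon K_\beta\to K_\alpha$ is a retraction and which is continuous, that is, for every limit ordinal $\rho<\delta$ the space $K_\rho$ together with the maps $(r^\rho_\alpha)_{\alpha<\rho}$ is the limit of $(K_\alpha, r^\beta_\alpha)_{\alpha\le\beta<\rho}$. Let $\mathcal R$ be the smallest class of spaces that contains all compact metrizable spaces and is closed under limits of retractive inverse sequences. \textbf{Theorem.} Let $X$ be a compact Hausdorff space that is a retract of a space from the class $\mathcal R$. Then the first \v{C}ech cohomology group $H^1(X;\mathbb Z)$ (the direct limit, over all open covers $\mathcal U$ of $X$ directed by refinement, of the first cohomology groups with integer coefficients of the nerves of $\mathcal U$) is isomorphic to a direct sum of countable abelian groups. -/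

import Mathlib

open scoped DirectSum

universe u

namespace Cech

/-- An open cover of `X`: a collection of open sets whose union is `X`. -/
structure Cover (X : Type u) [TopologicalSpace X] where
  sets : Set (Set X)
  isOpen : ∀ s ∈ sets, IsOpen s
  sUnion_eq : ⋃₀ sets = Set.univ

namespace Cover

variable {X : Type u} [TopologicalSpace X]

/-- `U ≤ V` means that `V` refines `U`, so the finer covers are the larger ones. -/
instance : Preorder (Cover X) where
  le U V := ∀ v ∈ V.sets, ∃ w ∈ U.sets, v ⊆ w
  le_refl U v hv := ⟨v, hv, subset_rfl⟩
  le_trans U V W hUV hVW w hw := by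
    obtain ⟨v, hv, hwv⟩ := hVW w hw
    obtain ⟨a, ha, hva⟩ := hUV v hv
    exact ⟨a, ha, hwv.trans hva⟩

instance : Nonempty (Cover X) :=
  ⟨⟨{Set.univ}, by simp, by simp⟩⟩

/-- Any two open covers have a common refinement. -/
instance : IsDirected (Cover X) (· ≤ ·) where
  directed U V := by
    refine ⟨⟨{s | ∃ a ∈ U.sets, ∃ b ∈ V.sets, s = a ∩ b}, ?_, ?_⟩, ?_, ?_⟩
    · rintro _ ⟨a, ha, b, hb, rfl⟩
      exact (U.isOpen a ha).inter (V.isOpen b hb)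
    · refine Set.eq_univ_of_forall fun x => ?_
      obtain ⟨a, ha, hxa⟩ := Set.mem_sUnion.1 (U.sUnion_eq.symm ▸ Set.mem_univ x)
      obtain ⟨b, hb, hxb⟩ := Set.mem_sUnion.1 (V.sUnion_eq.symm ▸ Set.mem_univ x)
      exact ⟨a ∩ b, ⟨a, ha, b, hb, rfl⟩, hxa, hxb⟩
    · rintro _ ⟨a, ha, b, hb, rfl⟩
      exact ⟨a, ha, Set.inter_subset_left⟩
    · rintro _ ⟨a, ha, b, hb, rfl⟩
      exact ⟨b, hb, Set.inter_subset_right⟩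

/-- The ordered 1-simplices of the nerve of `U`: pairs of members of `U` that meet. -/
def Edge (U : Cover X) : Type u :=
  {p : U.sets × U.sets // ((p.1 : Set X) ∩ p.2).Nonempty}

/-- The edge given by two members that meet. -/
def edge {U : Cover X} (a b : U.sets) (h : ((a : Set X) ∩ b).Nonempty) : U.Edge :=
  ⟨(a, b), h⟩

/-- The integral 1-cocycles of the nerve of `U`. -/
def Z1 (U : Cover X) : AddSubgroup (U.Edge → ℤ) where
  carrier := {c | ∀ (a b d : U.sets) (h : ((a : Set X) ∩ b ∩ d).Nonempty),
    c (edge b d (h.mono fun _ hx => ⟨hx.1.2, hx.2⟩))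
      - c (edge a d (h.mono fun _ hx => ⟨hx.1.1, hx.2⟩))
      + c (edge a b (h.mono fun _ hx => hx.1)) = 0}
  zero_mem' := by intro a b d h; simp
  add_mem' := by
    intro c c' hc hc' a b d h
    have h1 := hc a b d h
    have h2 := hc' a b d h
    simp only [Pi.add_apply]
    linarith
  neg_mem' := by
    intro c hc a b d h
    have h1 := hc a b d h
    simp only [Pi.neg_apply]
    linarith

/-- The coboundary from 0-cochains to 1-cocycles, `(δ f) (a, b) = f b - f a`. (Values of `f` at an
empty member of `U`, which is not a vertex of the nerve, play no role.) -/
def δ (U : Cover X) : (U.sets → ℤ) →+ U.Z1 where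
  toFun f := ⟨fun e => f e.1.2 - f e.1.1, by intro a b d h; simp only [edge]; ring⟩
  map_zero' := by ext e; simp
  map_add' f g := by ext e; simp only [Pi.add_apply, AddSubgroup.coe_add]; ring

/-- The first cohomology group `H¹(N(U); ℤ)` of the nerve of the cover `U`. -/
def H1 (U : Cover X) : Type u := U.Z1 ⧸ (δ U).range

instance (U : Cover X) : AddCommGroup U.H1 :=
  inferInstanceAs (AddCommGroup (U.Z1 ⧸ (δ U).range))

/-- The map on edges induced by a refinement map `φ` (each `v ∈ V` is contained in `φ v ∈ U`). -/
def edgeMap {U V : Cover X} (φ : V.sets → U.sets) (hφ : ∀ v : V.sets, (v : Set X) ⊆ φ v)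
    (e : V.Edge) : U.Edge :=
  edge (φ e.1.1) (φ e.1.2) (e.2.mono (Set.inter_subset_inter (hφ _) (hφ _)))

/-- Pull-back of cocycles along a refinement map. -/
def pullZ1 {U V : Cover X} (φ : V.sets → U.sets) (hφ : ∀ v : V.sets, (v : Set X) ⊆ φ v) :
    U.Z1 →+ V.Z1 where
  toFun c := ⟨fun e => c.1 (edgeMap φ hφ e), fun a b d h =>
    c.2 (φ a) (φ b) (φ d)
      (h.mono (Set.inter_subset_inter (Set.inter_subset_inter (hφ _) (hφ _)) (hφ _)))⟩
  map_zero' := rfl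
  map_add' _ _ := rfl

/-- The map in cohomology induced by a refinement map. -/
def pullH1 {U V : Cover X} (φ : V.sets → U.sets) (hφ : ∀ v : V.sets, (v : Set X) ⊆ φ v) :
    U.H1 →+ V.H1 :=
  QuotientAddGroup.map _ _ (pullZ1 φ hφ) (by
    rintro _ ⟨f, rfl⟩
    exact ⟨fun v => f (φ v), rfl⟩)

/-- The map in cohomology does not depend on the choice of the refinement map. -/
theorem pullH1_eq {U V : Cover X} (φ ψ : V.sets → U.sets) (hφ : ∀ v : V.sets, (v : Set X) ⊆ φ v)
    (hψ : ∀ v : V.sets, (v : Set X) ⊆ ψ v) : pullH1 φ hφ = pullH1 ψ hψ := by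
  classical
  ext x
  obtain ⟨c, rfl⟩ := QuotientAddGroup.mk_surjective x
  refine (QuotientAddGroup.eq (s := (δ V).range)).2 ⟨fun v =>
    if h : (v : Set X).Nonempty then
      c.1 (edge (φ v) (ψ v) (h.mono fun _ hx => ⟨hφ v hx, hψ v hx⟩)) else 0, ?_⟩
  ext ⟨⟨a, b⟩, hab⟩
  have ha : (a : Set X).Nonempty := hab.mono Set.inter_subset_left
  have hb : (b : Set X).Nonempty := hab.mono Set.inter_subset_right
  have h1 := c.2 (φ a) (φ b) (ψ b) (hab.mono fun _ hx => ⟨⟨hφ a hx.1, hφ b hx.2⟩, hψ b hx.2⟩)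
  have h2 := c.2 (φ a) (ψ a) (ψ b) (hab.mono fun _ hx => ⟨⟨hφ a hx.1, hψ a hx.1⟩, hψ b hx.2⟩)
  change (if h : (b : Set X).Nonempty then _ else 0) - (if h : (a : Set X).Nonempty then _ else 0) =
    -(c.1 (edge (φ a) (φ b) _)) + c.1 (edge (ψ a) (ψ b) _)
  rw [dif_pos ha, dif_pos hb]
  linarith

/-- The canonical map `H¹(N(U); ℤ) → H¹(N(V); ℤ)` for a cover `V` that refines `U`. -/
noncomputable def res (U V : Cover X) (h : U ≤ V) : U.H1 →+ V.H1 :=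
  pullH1 (fun v => ⟨(h v v.2).choose, (h v v.2).choose_spec.1⟩)
    (fun v => (h v v.2).choose_spec.2)

/-- The groups `H¹(N(U); ℤ)` form a directed system. -/
instance : DirectedSystem (fun U : Cover X => U.H1) (fun U V h => res U V h) where
  map_self U x := by
    rw [res, pullH1_eq _ id _ (fun _ => subset_rfl)]
    obtain ⟨c, rfl⟩ := QuotientAddGroup.mk_surjective x
    rfl
  map_map W V U hUV hVW x := by
    obtain ⟨c, rfl⟩ := QuotientAddGroup.mk_surjective x
    exact DFunLike.congr_fun (pullH1_eq (U := U) (V := W)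
      (fun w => ⟨(hUV _ (hVW w w.2).choose_spec.1).choose,
        (hUV _ (hVW w w.2).choose_spec.1).choose_spec.1⟩) _
      (fun w => ((hVW w w.2).choose_spec.2).trans
        (hUV _ (hVW w w.2).choose_spec.1).choose_spec.2) _) (QuotientAddGroup.mk c)

end Cover

open scoped Classical in
/-- The first Čech cohomology group `H¹(X; ℤ)`: the direct limit of `H¹(N(U); ℤ)` over all open
covers `U` of `X`, directed by refinement. -/
noncomputable abbrev H1 (X : Type u) [TopologicalSpace X] : Type u :=
  AddCommGroup.DirectLimit (fun U : Cover X => U.H1) Cover.res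

end Cech

/-- A retraction: a continuous map with a continuous right inverse. -/
def IsRetraction {X Y : Type u} [TopologicalSpace X] [TopologicalSpace Y] (f : C(X, Y)) : Prop :=
  ∃ j : C(Y, X), f.comp j = ContinuousMap.id Y

/-- `X` with the projections `p` is the limit of the inverse system `(K, r)`: the map
`x ↦ (p i x)` is a homeomorphism of `X` onto the subspace of threads of the product. -/
structure IsInverseLimit {ι : Type u} [LinearOrder ι] {K : ι → Type u}
    [∀ i, TopologicalSpace (K i)] (r : ∀ i j, i ≤ j → C(K j, K i))
    {X : Type u} [TopologicalSpace X] (p : ∀ i, C(X, K i)) : Prop where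
  isEmbedding : Topology.IsEmbedding fun (x : X) (i : ι) => p i x
  range_eq : Set.range (fun (x : X) (i : ι) => p i x) =
    {t : ∀ i, K i | ∀ (i j : ι) (h : i ≤ j), r i j h (t j) = t i}

/-- A retractive inverse sequence indexed by a well-ordered set `ι`: an inverse system which is
continuous at every limit element and in which all bonding maps are retractions. -/
structure IsRetractiveSequence {ι : Type u} [LinearOrder ι] [WellFoundedLT ι] {K : ι → Type u}
    [∀ i, TopologicalSpace (K i)] (r : ∀ i j, i ≤ j → C(K j, K i)) : Prop where
  map_self : ∀ i, r i i le_rfl = ContinuousMap.id (K i)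
  map_comp : ∀ (i j k : ι) (hij : i ≤ j) (hjk : j ≤ k),
    (r i j hij).comp (r j k hjk) = r i k (hij.trans hjk)
  continuous : ∀ ρ : ι, Order.IsSuccLimit ρ →
    IsInverseLimit (ι := Set.Iio ρ) (K := fun i => K i)
      (fun i j h => r i j h) (fun i => r i ρ (le_of_lt i.2))
  isRetraction : ∀ (i j : ι) (h : i ≤ j), IsRetraction (r i j h)

/-- Class `𝓡`: the smallest class of spaces which contains all compact metrizable spaces and is
closed under limits of (transfinite, continuous) retractive inverse sequences. All its members are
compact Hausdorff. -/
inductive ClassR : ∀ (X : Type u) [TopologicalSpace X], Prop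
  | of_metrizable (X : Type u) [TopologicalSpace X] [CompactSpace X]
      [TopologicalSpace.MetrizableSpace X] : ClassR X
  | of_limit {ι : Type u} [LinearOrder ι] [WellFoundedLT ι] (K : ι → Type u)
      [∀ i, TopologicalSpace (K i)] (r : ∀ i j, i ≤ j → C(K j, K i))
      (hr : IsRetractiveSequence r) (hK : ∀ i, ClassR (K i))
      (X : Type u) [TopologicalSpace X] (p : ∀ i, C(X, K i)) (hX : IsInverseLimit r p) : ClassR X

/-! For compact Hausdorff `X`, the group `H¹(X; ℤ)` is the Bruschlinsky group `C(X, S¹) / exp C(X,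
ℝ)` (`Cech.nonempty_addEquiv_bruschlinsky`), a contravariant functor turning retractions into split
injections. Two circle-valued maps at uniform distance less than 1 have the same class. Hence the
group is countable when `X` is compact metrizable, and by Stone–Weierstrass the group of an inverse
limit with surjective projections is the direct limit of the groups of the stages (`exists_map_eq`,
`exists_map_eq_zero`).

For a retractive sequence, the groups of the stages therefore form a well-ordered chain of
subgroups, continuous at limit indices, each a direct summand of the next. The whole group is the
direct sum of the successive complements (`nonempty_addEquiv_directSum_ker`). Each complement is a
summand of the group of a stage, which by induction is a direct sum of countable groups; Kaplansky's
theorem (`IsDirectSumOfCountable.of_retract`) says that such a summand is again a sum of this kind.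
Kaplansky's theorem rests on the same splitting lemma, and it also handles the final passage to a
retract. -/

/-! ### Direct sums of countable groups and split filtrations -/

/-- `G` is isomorphic to a direct sum of countable abelian groups. -/
def IsDirectSumOfCountable (G : Type u) [AddCommGroup G] : Prop :=
  ∃ (I : Type u) (A : I → Type u) (_ : ∀ i, AddCommGroup (A i)),
    (∀ i, Countable (A i)) ∧ Nonempty (G ≃+ ⨁ i, A i)

namespace IsDirectSumOfCountable

theorem of_addEquiv {G H : Type u} [AddCommGroup G] [AddCommGroup H] (e : G ≃+ H)
    (hH : IsDirectSumOfCountable H) : IsDirectSumOfCountable G := by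
  obtain ⟨I, A, inst, hA, ⟨φ⟩⟩ := hH
  exact ⟨I, A, inst, hA, ⟨e.trans φ⟩⟩

theorem of_countable (G : Type u) [AddCommGroup G] [Countable G] : IsDirectSumOfCountable G :=
  ⟨PUnit, fun _ => G, inferInstance, fun _ => inferInstance, ⟨(DirectSum.id G PUnit).symm⟩⟩

theorem directSum {J : Type u} {A : J → Type u} [∀ j, AddCommGroup (A j)]
    (hA : ∀ j, IsDirectSumOfCountable (A j)) : IsDirectSumOfCountable (⨁ j, A j) := by
  classical
  choose I B inst hB e using hA
  refine ⟨Σ j, I j, fun x => B x.1 x.2, fun x => inst x.1 x.2, fun x => hB x.1 x.2, ⟨?_⟩⟩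
  refine AddEquiv.trans (DFinsupp.mapRange.addEquiv fun j => (e j).some) ?_
  exact (DirectSum.sigmaCurryEquiv (δ := fun j i => B j i)).symm

end IsDirectSumOfCountable

/-- A well-ordered filtration in which each term `N i` retracts onto the union of the earlier ones
splits as the direct sum of the kernels of these retractions. -/
theorem nonempty_addEquiv_directSum_ker {G : Type u} [AddCommGroup G] {ι : Type u} [LinearOrder ι]
    [WellFoundedLT ι] (N : ι → AddSubgroup G) (htop : ∀ x, x ≠ 0 → ∃ i, x ∈ N i)
    (hmono : Monotone N) (π : ∀ i, N i →+ G)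
    (hπ : ∀ i x, π i x ≠ 0 → ∃ j < i, π i x ∈ N j)
    (hfix : ∀ i (x : N i), ∀ j < i, (x : G) ∈ N j → π i x = x) :
    Nonempty (G ≃+ ⨁ i, (π i).ker) := by
  classical
  let F : (⨁ i, (π i).ker) →+ G :=
    DirectSum.toAddMonoid fun i => (N i).subtype.comp (π i).ker.subtype
  have hsurj : ∀ i, ∀ x ∈ N i, ∃ y, F y = x := by
    intro i
    induction i using WellFoundedLT.induction with
    | ind i ih =>
      intro x hx
      -- The value 0 is a separate case throughout: for the least `i` the union of the earlier terms
      -- is empty, not `{0}`.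
      have hmem : π i ⟨x, hx⟩ ∈ N i := by
        by_cases h0 : π i ⟨x, hx⟩ = 0
        · rw [h0]; exact zero_mem _
        · obtain ⟨j, hj, h⟩ := hπ i _ h0
          exact hmono hj.le h
      have hidem : π i ⟨π i ⟨x, hx⟩, hmem⟩ = π i ⟨x, hx⟩ := by
        by_cases h0 : π i ⟨x, hx⟩ = 0
        · have : (⟨π i ⟨x, hx⟩, hmem⟩ : N i) = 0 := Subtype.ext h0
          rw [this, map_zero, h0]
        · obtain ⟨j, hj, h⟩ := hπ i _ h0
          exact hfix i _ j hj h
      obtain ⟨y, hy⟩ : ∃ y, F y = π i ⟨x, hx⟩ := by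
        by_cases h0 : π i ⟨x, hx⟩ = 0
        · exact ⟨0, by rw [map_zero, h0]⟩
        · obtain ⟨j, hj, h⟩ := hπ i _ h0
          exact ih j hj _ h
      -- Split `x = (x - π x) + π x`: the first part is in the kernel, the second in an earlier
      -- term.
      have hk : (⟨x, hx⟩ - ⟨π i ⟨x, hx⟩, hmem⟩ : N i) ∈ (π i).ker := by
        rw [AddMonoidHom.mem_ker, map_sub, hidem, sub_self]
      refine ⟨DirectSum.of (fun i => (π i).ker) i ⟨_, hk⟩ + y, ?_⟩
      rw [map_add, hy, DirectSum.toAddMonoid_of]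
      simp
  have hinj : Function.Injective F := by
    rw [injective_iff_map_eq_zero]
    intro y hy
    by_contra hne
    have hsne : (DFinsupp.support y).Nonempty := by
      rw [Finset.nonempty_iff_ne_empty]
      exact fun h => hne (DFinsupp.support_eq_empty.1 h)
    -- The top component is minus the sum of the lower ones, so it lies in an earlier term and is
    -- fixed by `π i`; being in the kernel, it vanishes.
    set i := (DFinsupp.support y).max' hsne
    have hiy : y i ≠ 0 := (DFinsupp.mem_support_iff).1 (Finset.max'_mem _ hsne)
    have hsum : ∑ j ∈ DFinsupp.support y, ((y j : N j) : G) = 0 := by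
      rw [← hy]
      conv_rhs => rw [← DirectSum.sum_support_of y]
      rw [map_sum]
      refine Finset.sum_congr rfl fun j _ => ?_
      rw [DirectSum.toAddMonoid_of]
      rfl
    rw [← Finset.add_sum_erase _ _ (Finset.max'_mem _ hsne)] at hsum
    have hlt : ∀ j ∈ (DFinsupp.support y).erase i, j < i := fun j hj =>
      lt_of_le_of_ne (Finset.le_max' _ _ (Finset.mem_of_mem_erase hj)) (Finset.ne_of_mem_erase hj)
    have hyi : ((y i : N i) : G) = -∑ j ∈ (DFinsupp.support y).erase i, ((y j : N j) : G) :=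
      eq_neg_of_add_eq_zero_left hsum
    have hyi0 : ((y i : N i) : G) ≠ 0 := fun h => hiy (Subtype.ext (Subtype.ext h))
    have hne' : ((DFinsupp.support y).erase i).Nonempty := by
      by_contra h
      rw [Finset.not_nonempty_iff_eq_empty] at h
      rw [h, Finset.sum_empty, neg_zero] at hyi
      exact hyi0 hyi
    have hmem : ((y i : N i) : G) ∈ N (((DFinsupp.support y).erase i).max' hne') := by
      rw [hyi]
      exact neg_mem (sum_mem fun j hj => hmono (Finset.le_max' _ _ hj) (y j).1.2)
    have := hfix i _ _ (hlt _ (Finset.max'_mem _ hne')) hmem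
    rw [AddMonoidHom.mem_ker.1 (y i).2] at this
    exact hyi0 this.symm
  refine ⟨(AddEquiv.ofBijective F ⟨hinj, fun x => ?_⟩).symm⟩
  by_cases hx : x = 0
  · exact ⟨0, by rw [map_zero, hx]⟩
  · exact (htop x hx).elim fun i hi => hsurj i x hi

/-! ### Kaplansky's theorem on direct summands -/

section Kaplansky

variable {I : Type u} (A : I → Type u) [∀ i, AddCommGroup (A i)]

/-- The elements of a direct sum that are supported in `J`. -/
def DirectSum.supportedIn (J : Set I) : AddSubgroup (⨁ i, A i) where
  carrier := {x | ∀ k ∉ J, x k = 0}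
  zero_mem' _ _ := rfl
  add_mem' hx hy k hk := by rw [DirectSum.add_apply, hx k hk, hy k hk, add_zero]
  neg_mem' {x} hx k hk := by
    change -(x k) = 0
    rw [hx k hk, neg_zero]

variable {A}

theorem DirectSum.countable_supportedIn [∀ i, Countable (A i)] {J : Set I} (hJ : J.Countable) :
    Countable (DirectSum.supportedIn A J) := by
  classical
  have := hJ.to_subtype
  have : Countable (Π₀ j : J, A j) := inferInstance
  refine Function.Injective.countable
    (f := fun x : DirectSum.supportedIn A J => DFinsupp.subtypeDomain (· ∈ J) x.1) ?_
  intro x y h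
  ext k
  by_cases hk : k ∈ J
  · exact DFunLike.congr_fun h (⟨k, hk⟩ : J)
  · rw [x.2 k hk, y.2 k hk]

open Classical in
/-- Restriction of an element of a direct sum to the coordinates in `J`. -/
noncomputable def DirectSum.restrictTo (J : Set I) : (⨁ i, A i) →+ ⨁ i, A i :=
  DFinsupp.filterAddMonoidHom A (· ∈ J)

theorem DirectSum.restrictTo_mem (J : Set I) (x : ⨁ i, A i) :
    DirectSum.restrictTo J x ∈ DirectSum.supportedIn A J := by
  classical
  intro k hk
  exact (DFinsupp.filter_apply (· ∈ J) k x).trans (if_neg hk)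

theorem DirectSum.restrictTo_apply {J : Set I} (x : ⨁ i, A i) {k : I} (hk : k ∈ J) :
    DirectSum.restrictTo J x k = x k := by
  classical
  exact (DFinsupp.filter_apply (· ∈ J) k x).trans (if_pos hk)

theorem DirectSum.restrictTo_eq {J : Set I} {x : ⨁ i, A i}
    (hx : x ∈ DirectSum.supportedIn A J) : DirectSum.restrictTo J x = x := by
  ext k
  by_cases hk : k ∈ J
  · exact DirectSum.restrictTo_apply x hk
  · rw [hx k hk, DirectSum.restrictTo_mem J x k hk]

/-- Every index lies in a countable set of indices whose partial sum is stable under a given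
endomorphism. -/
theorem DirectSum.exists_countable_stable [∀ i, Countable (A i)] (e : (⨁ i, A i) →+ ⨁ i, A i) :
    ∃ c : I → Set I, ∀ i, i ∈ c i ∧ (c i).Countable ∧
      ∀ x ∈ DirectSum.supportedIn A (c i), e x ∈ DirectSum.supportedIn A (c i) := by
  classical
  -- `T j` collects the coordinates reached by `e` from the summand `A j`. It is countable, and
  -- iterating it from `{i}` gives the stable set.
  let T : I → Set I := fun j => ⋃ a : A j, {k | e (DirectSum.of A j a) k ≠ 0}
  have hT : ∀ j, (T j).Countable := fun j =>
    Set.countable_iUnion fun a => (DFinsupp.finite_support (e (DirectSum.of A j a))).countable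
  let S : I → ℕ → Set I := fun i n => Nat.rec {i} (fun _ s => ⋃ j ∈ s, T j) n
  have hS : ∀ i n, (S i n).Countable := by
    intro i n
    induction n with
    | zero => exact Set.countable_singleton i
    | succ n ih => exact ih.biUnion fun j _ => hT j
  refine ⟨fun i => ⋃ n, S i n, fun i => ⟨Set.mem_iUnion.2 ⟨0, rfl⟩,
    Set.countable_iUnion (hS i), fun x hx k hk => ?_⟩⟩
  rw [← DirectSum.sum_support_of x, map_sum, DirectSum.sum_apply]
  refine Finset.sum_eq_zero fun j hj => ?_
  by_contra hne
  have hjx : x j ≠ 0 := DFinsupp.mem_support_iff.1 hj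
  have hjm : j ∈ ⋃ n, S i n := by
    by_contra h
    exact hjx (hx j h)
  obtain ⟨n, hn⟩ := Set.mem_iUnion.1 hjm
  exact hk (Set.mem_iUnion.2 ⟨n + 1, Set.mem_biUnion hn (Set.mem_iUnion.2 ⟨x j, hne⟩)⟩)

/-- Kaplansky's theorem: a direct summand of a direct sum of countable abelian groups is again
a direct sum of countable abelian groups. -/
theorem IsDirectSumOfCountable.of_retract {G P : Type u} [AddCommGroup G] [AddCommGroup P]
    (hG : IsDirectSumOfCountable G) (s : P →+ G) (e : G →+ P) (hes : ∀ x, e (s x) = x) :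
    IsDirectSumOfCountable P := by
  classical
  obtain ⟨I, A, inst, hA, ⟨φ⟩⟩ := hG
  obtain ⟨s', e', hes'⟩ : ∃ (s' : P →+ ⨁ i, A i) (e' : (⨁ i, A i) →+ P), ∀ x, e' (s' x) = x :=
    ⟨φ.toAddMonoidHom.comp s, e.comp φ.symm.toAddMonoidHom, fun x => by simp [hes]⟩
  obtain ⟨c, hc⟩ := DirectSum.exists_countable_stable (s'.comp e')
  -- Any well-order will do: `P` is filtered by the unions of the `c j` over initial segments.
  let : LinearOrder I := linearOrderOfSTO WellOrderingRel
  have : WellFoundedLT I := inferInstanceAs (IsWellFounded I WellOrderingRel)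
  have stable_iUnion : ∀ (L : Set I) x, x ∈ DirectSum.supportedIn A (⋃ j ∈ L, c j) →
      s' (e' x) ∈ DirectSum.supportedIn A (⋃ j ∈ L, c j) := by
    intro L x hx k hk
    rw [← DirectSum.sum_support_of x, map_sum, map_sum, DirectSum.sum_apply]
    refine Finset.sum_eq_zero fun l hl => ?_
    have hlm : l ∈ ⋃ j ∈ L, c j := by
      by_contra h
      exact DFinsupp.mem_support_iff.1 hl (hx l h)
    obtain ⟨j, hj, hlj⟩ := Set.mem_iUnion₂.1 hlm
    refine (hc j).2.2 _ (fun m hm => DirectSum.of_eq_of_ne _ _ _ ?_) k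
      fun h => hk (Set.mem_iUnion₂.2 ⟨j, hj, h⟩)
    rintro rfl
    exact hm hlj
  let N : I → AddSubgroup P := fun i => (DirectSum.supportedIn A (⋃ j ∈ Set.Iic i, c j)).comap s'
  -- Truncate to the earlier coordinates and project back to `P`. Stability under `s' ∘ e'` keeps
  -- the result supported there.
  let π : ∀ i, N i →+ P := fun i =>
    (e'.comp ((DirectSum.restrictTo (⋃ j ∈ Set.Iio i, c j)).comp s')).comp (N i).subtype
  have hπN : ∀ i x, s' (π i x) ∈ DirectSum.supportedIn A (⋃ j ∈ Set.Iio i, c j) := fun i x =>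
    stable_iUnion _ _ (DirectSum.restrictTo_mem _ _)
  -- Supports are finite, so finitely many of the sets `c j` suffice, and their indices have a
  -- maximum in `L`.
  have finite_bound : ∀ (L : Set I) (x : ⨁ i, A i), L.Nonempty →
      x ∈ DirectSum.supportedIn A (⋃ j ∈ L, c j) →
      ∃ j ∈ L, x ∈ DirectSum.supportedIn A (⋃ l ∈ Set.Iic j, c l) := by
    intro L x hL hx
    have hch : ∀ k : I, ∃ j ∈ L, x k ≠ 0 → k ∈ c j := by
      intro k
      by_cases h : x k = 0
      · exact ⟨hL.some, hL.some_mem, fun h' => (h' h).elim⟩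
      · by_contra hcon
        push Not at hcon
        refine h (hx k fun hk => ?_)
        obtain ⟨j, hj, hkj⟩ := Set.mem_iUnion₂.1 hk
        exact (hcon j hj).2 hkj
    choose g hgL hg using hch
    obtain ⟨j, hjL, hj⟩ : ∃ j ∈ L, ∀ k ∈ DFinsupp.support x, g k ≤ j := by
      rcases (DFinsupp.support x).eq_empty_or_nonempty with h | h
      · exact ⟨hL.some, hL.some_mem, by simp [h]⟩
      · obtain ⟨k, hk, hmax⟩ := Finset.exists_max_image _ g h
        exact ⟨g k, hgL k, hmax⟩
    refine ⟨j, hjL, fun k hk => ?_⟩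
    by_contra hne
    exact hk (Set.mem_iUnion₂.2 ⟨g k, hj k (DFinsupp.mem_support_iff.2 hne), hg k hne⟩)
  have hmono' : ∀ {L M : Set I}, L ⊆ M → DirectSum.supportedIn A (⋃ j ∈ L, c j) ≤
      DirectSum.supportedIn A (⋃ j ∈ M, c j) := fun h x hx k hk =>
    hx k fun hk' => hk (Set.biUnion_subset_biUnion_left h hk')
  have key : Nonempty (P ≃+ ⨁ i, (π i).ker) := by
    refine nonempty_addEquiv_directSum_ker N ?_ ?_ π ?_ ?_
    · intro x hx
      have hI : Nonempty I := by
        by_contra h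
        rw [not_nonempty_iff] at h
        exact hx (by rw [← hes' x, show s' x = 0 from Subsingleton.elim _ _, map_zero])
      obtain ⟨j, -, hj⟩ := finite_bound Set.univ (s' x) Set.univ_nonempty fun k hk =>
        (hk (Set.mem_iUnion₂.2 ⟨k, trivial, (hc k).1⟩)).elim
      exact ⟨j, hj⟩
    · exact fun i j hij x hx => hmono' (Set.Iic_subset_Iic.2 hij) hx
    · intro i x hx
      have hL : (Set.Iio i).Nonempty := by
        by_contra h
        rw [Set.not_nonempty_iff_eq_empty] at h
        apply hx
        rw [← hes' (π i x)]
        have h0 : s' (π i x) = 0 := by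
          ext k
          exact hπN i x k (by simp [h])
        rw [h0, map_zero]
      obtain ⟨j, hj, h⟩ := finite_bound _ _ hL (hπN i x)
      exact ⟨j, hj, h⟩
    · intro i x j hj hx
      change e' (DirectSum.restrictTo _ (s' x)) = x
      rw [DirectSum.restrictTo_eq (hmono' (Set.Iic_subset_Iio.2 hj) hx), hes']
  obtain ⟨ψ⟩ := key
  refine .of_addEquiv ψ (.directSum fun i => ?_)
  have := DirectSum.countable_supportedIn (A := A) (hc i).2.1
  -- An element of the kernel is determined by its coordinates in `c i`: if these vanish, its
  -- support lies in the earlier sets, so `π i` fixes it and it is 0.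
  have : Countable (π i).ker := by
    refine Function.Injective.countable (f := fun x : (π i).ker =>
      (⟨DirectSum.restrictTo (c i) (s' x.1.1), DirectSum.restrictTo_mem _ _⟩ :
        DirectSum.supportedIn A (c i))) ?_
    intro x y hxy
    have hxy' : DirectSum.restrictTo (c i) (s' (x.1.1 - y.1.1)) = 0 := by
      rw [map_sub, map_sub, sub_eq_zero]
      exact congrArg Subtype.val hxy
    have hz : (x - y).1.1 = x.1.1 - y.1.1 := rfl
    have hmem : s' (x - y).1.1 ∈ DirectSum.supportedIn A (⋃ j ∈ Set.Iio i, c j) := by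
      intro k hk
      by_cases hki : k ∈ c i
      · rw [← DirectSum.restrictTo_apply (s' (x - y).1.1) hki, hz, hxy', DirectSum.zero_apply]
      · refine (x - y).1.2 k fun hk' => ?_
        obtain ⟨j, hj, hkj⟩ := Set.mem_iUnion₂.1 hk'
        rcases eq_or_lt_of_le (show j ≤ i from hj) with rfl | hlt
        · exact hki hkj
        · exact hk (Set.mem_iUnion₂.2 ⟨j, hlt, hkj⟩)
    have h0 : e' (DirectSum.restrictTo (⋃ j ∈ Set.Iio i, c j) (s' (x - y).1.1)) = 0 :=
      AddMonoidHom.mem_ker.1 (x - y).2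
    rw [DirectSum.restrictTo_eq hmem, hes', hz, sub_eq_zero] at h0
    exact Subtype.ext (Subtype.ext h0)
  exact .of_countable _

end Kaplansky

/-- A group with a well-ordered exhausting filtration by direct sums of countable groups, each of
which retracts onto the union of the earlier ones, is a direct sum of countable groups. -/
theorem IsDirectSumOfCountable.of_filtration {G : Type u} [AddCommGroup G] {ι : Type u}
    [LinearOrder ι] [WellFoundedLT ι] (N : ι → AddSubgroup G)
    (htop : ∀ x, x ≠ 0 → ∃ i, x ∈ N i) (hmono : Monotone N)
    (hπ : ∀ i, ∃ π : N i →+ G, (∀ x, π x ≠ 0 → ∃ j < i, π x ∈ N j) ∧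
      ∀ x : N i, ∀ j < i, (x : G) ∈ N j → π x = x)
    (hN : ∀ i, IsDirectSumOfCountable (N i)) : IsDirectSumOfCountable G := by
  choose π hπ hfix using hπ
  obtain ⟨φ⟩ := nonempty_addEquiv_directSum_ker N htop hmono π hπ hfix
  refine .of_addEquiv φ (.directSum fun i => ?_)
  have hmem : ∀ x, π i x ∈ N i := by
    intro x
    by_cases h0 : π i x = 0
    · rw [h0]; exact zero_mem _
    · obtain ⟨j, hj, h⟩ := hπ i _ h0
      exact hmono hj.le h
  have hidem : ∀ x, π i ⟨π i x, hmem x⟩ = π i x := by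
    intro x
    by_cases h0 : π i x = 0
    · have : (⟨π i x, hmem x⟩ : N i) = 0 := Subtype.ext h0
      rw [this, map_zero, h0]
    · obtain ⟨j, hj, h⟩ := hπ i _ h0
      exact hfix i _ j hj h
  -- `id - π i` projects `N i` onto the kernel, which is thus a direct summand.
  refine (hN i).of_retract (π i).ker.subtype
    ((AddMonoidHom.id (N i) - (π i).codRestrict (N i) hmem).codRestrict (π i).ker fun x => ?_)
    fun x => ?_
  · rw [AddMonoidHom.mem_ker, AddMonoidHom.sub_apply, map_sub, sub_eq_zero]
    exact (hidem x).symm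
  · apply Subtype.ext
    apply Subtype.ext
    have hx : π i x.1 = 0 := AddMonoidHom.mem_ker.1 x.2
    change (x.1 : G) - π i x.1 = x.1
    rw [hx, sub_zero]

/-! ### The Bruschlinsky group and its functoriality -/

/-- The continuous maps `X → S¹` that lift along `exp` to a continuous map `X → ℝ`. -/
def liftableMaps (X : Type u) [TopologicalSpace X] : Subgroup C(X, Circle) where
  carrier := {g | ∃ f : C(X, ℝ), ∀ x, Circle.exp (f x) = g x}
  one_mem' := ⟨0, fun x => by simp⟩
  mul_mem' := by
    rintro g h ⟨f, hf⟩ ⟨k, hk⟩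
    exact ⟨f + k, fun x => by simp [Circle.exp_add, hf, hk]⟩
  inv_mem' := by
    rintro g ⟨f, hf⟩
    exact ⟨-f, fun x => by simp [Circle.exp_neg, hf]⟩

/-- The Bruschlinsky group of `X`: maps `X → S¹` modulo those that lift to `ℝ`. -/
abbrev Bruschlinsky (X : Type u) [TopologicalSpace X] : Type u :=
  Additive (C(X, Circle) ⧸ liftableMaps X)

namespace Bruschlinsky

section Functoriality

variable {X Y Z : Type u} [TopologicalSpace X] [TopologicalSpace Y] [TopologicalSpace Z]

/-- The class of a map to the circle. -/
noncomputable def mk (g : C(X, Circle)) : Bruschlinsky X := Additive.ofMul (QuotientGroup.mk g)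

theorem mk_surjective : Function.Surjective (mk : C(X, Circle) → Bruschlinsky X) := fun x =>
  QuotientGroup.mk_surjective (s := liftableMaps X) (Additive.toMul x)

theorem mk_mul (g h : C(X, Circle)) : mk (g * h) = mk g + mk h := rfl

theorem mk_eq_zero {g : C(X, Circle)} : mk g = 0 ↔ g ∈ liftableMaps X :=
  QuotientGroup.eq_one_iff g

theorem mk_eq_mk {g h : C(X, Circle)} : mk g = mk h ↔ g⁻¹ * h ∈ liftableMaps X :=
  QuotientGroup.eq

/-- The homomorphism induced by a continuous map. -/
noncomputable def map (f : C(X, Y)) : Bruschlinsky Y →+ Bruschlinsky X :=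
  MonoidHom.toAdditive (QuotientGroup.map _ _ (ContinuousMap.compMonoidHom' f) (by
    rintro g ⟨k, hk⟩
    exact ⟨k.comp f, fun x => hk (f x)⟩))

theorem map_mk (f : C(X, Y)) (g : C(Y, Circle)) : map f (mk g) = mk (g.comp f) := rfl

theorem map_id : map (ContinuousMap.id X) = AddMonoidHom.id _ := by
  ext x
  rfl

theorem map_map (f : C(X, Y)) (g : C(Y, Z)) (x : Bruschlinsky Z) :
    map f (map g x) = map (g.comp f) x := by
  obtain ⟨h, rfl⟩ := mk_surjective x
  rfl

end Functoriality

end Bruschlinsky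

/-! ### Uniformly close circle-valued maps -/

section Approximation

variable {X : Type u} [TopologicalSpace X]

/-- The unit disc around 1 lies in the slit plane, where `Complex.arg` is continuous and provides
the lift. -/
theorem mem_liftableMaps_of_norm_sub_one_lt {g : C(X, Circle)}
    (hg : ∀ x, ‖(g x : ℂ) - 1‖ < 1) : g ∈ liftableMaps X := by
  have hs : ∀ x, (g x : ℂ) ∈ Complex.slitPlane := fun x => by
    have := Complex.mem_slitPlane_of_norm_lt_one (hg x)
    simpa using this
  exact ⟨⟨fun x => Complex.arg (g x), continuous_iff_continuousAt.2 fun x =>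
    (Complex.continuousAt_arg (hs x)).comp (f := fun x => (g x : ℂ)) (by fun_prop)⟩, fun x => Circle.exp_arg (g x)⟩

theorem inv_mul_mem_liftableMaps {g h : C(X, Circle)}
    (hg : ∀ x, ‖(h x : ℂ) - g x‖ < 1) : g⁻¹ * h ∈ liftableMaps X := by
  refine mem_liftableMaps_of_norm_sub_one_lt fun x => ?_
  have : (((g⁻¹ * h) x : Circle) : ℂ) - 1 = ((g x)⁻¹ : Circle) * ((h x : ℂ) - g x) := by
    rw [mul_sub, ← Circle.coe_mul, ← Circle.coe_mul, inv_mul_cancel]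
    simp
  rw [this, norm_mul, Circle.norm_coe, one_mul]
  exact hg x

/-- `C(X, Circle)` is separable, and every class meets a countable dense set because maps at
distance less than 1 are equivalent. -/
theorem Bruschlinsky.countable (X : Type u) [TopologicalSpace X] [CompactSpace X]
    [TopologicalSpace.MetrizableSpace X] : Countable (Bruschlinsky X) := by
  let := TopologicalSpace.metrizableSpaceMetric X
  obtain ⟨S, hS, hd⟩ := TopologicalSpace.exists_countable_dense C(X, Circle)
  have := hS.to_subtype
  refine Function.Surjective.countable (f := fun s : S => Bruschlinsky.mk s.1) fun x => ?_
  obtain ⟨g, rfl⟩ := Bruschlinsky.mk_surjective x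
  obtain ⟨h, hh, hgh⟩ := Metric.dense_iff.1 hd g 1 one_pos
  refine ⟨⟨h, hgh⟩, Bruschlinsky.mk_eq_mk.2 (inv_mul_mem_liftableMaps fun x => ?_)⟩
  rw [← Complex.dist_eq]
  change dist (g x) (h x) < 1
  rw [dist_comm]
  exact (ContinuousMap.dist_apply_le_dist x).trans_lt hh

end Approximation

/-! ### Continuity of the Bruschlinsky group along inverse limits -/

namespace IsInverseLimit

variable {ι : Type u} [LinearOrder ι] {K : ι → Type u} [∀ i, TopologicalSpace (K i)]
  {r : ∀ i j, i ≤ j → C(K j, K i)} {X : Type u} [TopologicalSpace X] {p : ∀ i, C(X, K i)}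

theorem comp_eq (hX : IsInverseLimit r p) {i j : ι} (h : i ≤ j) : (r i j h).comp (p j) = p i := by
  ext x
  have : (fun i => p i x) ∈ Set.range (fun (x : X) (i : ι) => p i x) := ⟨x, rfl⟩
  rw [hX.range_eq] at this
  exact this i j h

theorem compactSpace [∀ i, CompactSpace (K i)] [∀ i, T2Space (K i)] (hX : IsInverseLimit r p) :
    CompactSpace X := by
  have : Topology.IsClosedEmbedding fun (x : X) (i : ι) => p i x := by
    refine ⟨hX.isEmbedding, ?_⟩
    rw [hX.range_eq]
    simp only [Set.ofPred_forall]
    exact isClosed_iInter fun i => isClosed_iInter fun j => isClosed_iInter fun h =>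
      isClosed_eq (by fun_prop) (by fun_prop)
  exact this.compactSpace

theorem t2Space [∀ i, T2Space (K i)] (hX : IsInverseLimit r p) : T2Space X :=
  hX.isEmbedding.t2Space

/-- By compactness, it is enough to find, for every `j ≥ i`, a point of the product over `y` that is
coherent up to `j`. -/
theorem surjective [∀ i, CompactSpace (K i)] [∀ i, T2Space (K i)] (hX : IsInverseLimit r p)
    (hcomp : ∀ (i j k : ι) (hij : i ≤ j) (hjk : j ≤ k),
      (r i j hij).comp (r j k hjk) = r i k (hij.trans hjk))
    (hr : ∀ i j h, Function.Surjective (r i j h)) (i : ι) : Function.Surjective (p i) := by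
  intro y
  have hne : ∀ a, Nonempty (K a) := fun a => by
    rcases le_total i a with h | h
    · exact ⟨(hr i a h y).choose⟩
    · exact ⟨r a i h y⟩
  let S : Set.Ici i → Set (∀ a, K a) := fun j =>
    {t | t i = y ∧ ∀ (a b : ι) (h : a ≤ b), b ≤ j → r a b h (t b) = t a}
  have hanti : Antitone S := fun j k hjk t ht => ⟨ht.1, fun a b h hb => ht.2 a b h (hb.trans hjk)⟩
  have hclosed : ∀ j, IsClosed (S j) := by
    intro j
    simp only [S, Set.ofPred_and, Set.ofPred_forall]
    exact (isClosed_eq (by fun_prop) (by fun_prop)).inter <|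
      isClosed_iInter fun a => isClosed_iInter fun b => isClosed_iInter fun h =>
        isClosed_iInter fun _ => isClosed_eq (by fun_prop) (by fun_prop)
  have hnonempty : ∀ j, (S j).Nonempty := by
    intro j
    obtain ⟨z, hz⟩ := hr i j j.2 y
    -- Coordinates not below `j` are unconstrained and get arbitrary values.
    refine ⟨fun a => if h : a ≤ j then r a j h z else (hne a).some, ?_, fun a b h hb => ?_⟩
    · beta_reduce
      rw [dif_pos (show i ≤ j from j.2), hz]
    · beta_reduce
      rw [dif_pos hb, dif_pos (h.trans hb), ← hcomp a b j h hb]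
      rfl
  have : Nonempty (Set.Ici i) := ⟨⟨i, le_rfl⟩⟩
  obtain ⟨t, ht⟩ := IsCompact.nonempty_iInter_of_directed_nonempty_isCompact_isClosed S
    hanti.directed_ge hnonempty (fun j => (hclosed j).isCompact) hclosed
  rw [Set.mem_iInter] at ht
  have htm : t ∈ Set.range (fun (x : X) (i : ι) => p i x) := by
    rw [hX.range_eq]
    intro a b h
    exact (ht ⟨max i b, le_max_left _ _⟩).2 a b h (le_max_right _ _)
  obtain ⟨x, hx⟩ := htm
  exact ⟨x, (congrFun hx i).trans (ht ⟨i, le_rfl⟩).1⟩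

/-- Functions that factor through some stage are dense among the functions on the limit. -/
theorem exists_approx [Nonempty ι] [∀ i, CompactSpace (K i)] [∀ i, T2Space (K i)]
    (hX : IsInverseLimit r p) (F : C(X, ℂ)) {ε : ℝ} (hε : 0 < ε) :
    ∃ i, ∃ h : C(K i, ℂ), ∀ x, ‖h (p i x) - F x‖ < ε := by
  have := hX.compactSpace
  have := hX.t2Space
  have lift : ∀ {i j : ι} (_ : i ≤ j) (h : C(K i, ℂ)),
      ∃ h' : C(K j, ℂ), h'.comp (p j) = h.comp (p i) := fun {i j} hij h =>
    ⟨h.comp (r i j hij), by rw [ContinuousMap.comp_assoc, hX.comp_eq]⟩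
  have pair : ∀ {F G : C(X, ℂ)}, (∃ i, ∃ h : C(K i, ℂ), h.comp (p i) = F) →
      (∃ i, ∃ h : C(K i, ℂ), h.comp (p i) = G) →
      ∃ i, ∃ h k : C(K i, ℂ), h.comp (p i) = F ∧ k.comp (p i) = G := by
    rintro _ _ ⟨i, h, rfl⟩ ⟨j, k, rfl⟩
    obtain ⟨h', hh'⟩ := lift (le_max_left i j) h
    obtain ⟨k', hk'⟩ := lift (le_max_right i j) k
    exact ⟨max i j, h', k', hh', hk'⟩
  -- Stone–Weierstrass applies: two functions factor through a common stage, and the projections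
  -- separate points.
  let A : StarSubalgebra ℂ C(X, ℂ) :=
    { carrier := {F | ∃ i, ∃ h : C(K i, ℂ), h.comp (p i) = F}
      mul_mem' := by
        intro F G hF hG
        obtain ⟨i, h, k, rfl, rfl⟩ := pair hF hG
        exact ⟨i, h * k, rfl⟩
      add_mem' := by
        intro F G hF hG
        obtain ⟨i, h, k, rfl, rfl⟩ := pair hF hG
        exact ⟨i, h + k, rfl⟩
      algebraMap_mem' := fun z => ⟨Classical.arbitrary ι, algebraMap ℂ _ z, rfl⟩
      star_mem' := by
        rintro _ ⟨i, h, rfl⟩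
        exact ⟨i, star h, rfl⟩ }
  have hsep : A.SeparatesPoints := by
    intro x y hxy
    obtain ⟨i, hi⟩ : ∃ i, p i x ≠ p i y := by
      by_contra hcon
      push Not at hcon
      exact hxy (hX.isEmbedding.injective (funext hcon))
    obtain ⟨f, hf0, hf1, -⟩ := exists_continuous_zero_one_of_isClosed
      (isClosed_singleton (x := p i x)) (isClosed_singleton (x := p i y))
      (Set.disjoint_singleton.2 hi)
    refine ⟨_, ⟨((⟨fun t => (t : ℂ), Complex.continuous_ofReal⟩ : C(ℝ, ℂ)).comp f).comp (p i),
      ⟨i, _, rfl⟩, rfl⟩, ?_⟩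
    have h0 : f (p i x) = 0 := hf0 rfl
    have h1 : f (p i y) = 1 := hf1 rfl
    simp [h0, h1]
  have hdense := ContinuousMap.starSubalgebra_topologicalClosure_eq_top_of_separatesPoints A hsep
  have hF : F ∈ closure (A : Set C(X, ℂ)) := by
    rw [← StarSubalgebra.topologicalClosure_coe, hdense]
    trivial
  obtain ⟨G, ⟨i, h, rfl⟩, hG⟩ := Metric.mem_closure_iff.1 hF ε hε
  refine ⟨i, h, fun x => ?_⟩
  rw [← Complex.dist_eq, dist_comm]
  exact (ContinuousMap.dist_apply_le_dist (f := F) (g := h.comp (p i)) x).trans_lt hG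

end IsInverseLimit

namespace IsInverseLimit

variable {ι : Type u} [LinearOrder ι] {K : ι → Type u} [∀ i, TopologicalSpace (K i)]
  {r : ∀ i j, i ≤ j → C(K j, K i)} {X : Type u} [TopologicalSpace X] {p : ∀ i, C(X, K i)}

theorem exists_map_eq [Nonempty ι] [∀ i, CompactSpace (K i)] [∀ i, T2Space (K i)]
    (hX : IsInverseLimit r p) (hp : ∀ i, Function.Surjective (p i)) (x : Bruschlinsky X) :
    ∃ i y, Bruschlinsky.map (p i) y = x := by
  obtain ⟨g, rfl⟩ := Bruschlinsky.mk_surjective x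
  -- With error below 1/2, `h` vanishes nowhere on `K i` (as `p i` is onto), and normalizing it
  -- costs less than another 1/2.
  obtain ⟨i, h, hh⟩ := hX.exists_approx ⟨fun x => (g x : ℂ), by fun_prop⟩ (half_pos one_pos)
  have hne : ∀ y, h y ≠ 0 := by
    intro y hy
    obtain ⟨x, rfl⟩ := hp i y
    have := hh x
    rw [hy, zero_sub, norm_neg] at this
    change ‖(g x : ℂ)‖ < _ at this
    rw [Circle.norm_coe] at this
    norm_num at this
  let k : C(K i, Circle) :=
    ⟨fun y => ⟨h y / ‖h y‖, by
      rw [Submonoid.unitSphere, ← SetLike.mem_coe]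
      simp [hne y]⟩, by
      refine Continuous.subtype_mk (h.continuous.div₀ (by fun_prop) fun y => ?_) _
      simpa using hne y⟩
  refine ⟨i, Bruschlinsky.mk k, ?_⟩
  rw [Bruschlinsky.map_mk, eq_comm, Bruschlinsky.mk_eq_mk]
  refine inv_mul_mem_liftableMaps fun x => ?_
  change ‖h (p i x) / ‖h (p i x)‖ - g x‖ < 1
  have h1 : ‖h (p i x) - g x‖ < 1 / 2 := hh x
  have h2 : ‖h (p i x) / ‖h (p i x)‖ - h (p i x)‖ = |‖h (p i x)‖ - 1| := by
    have h0 : (‖h (p i x)‖ : ℂ) ≠ 0 := by simpa using hne (p i x)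
    have : h (p i x) / ‖h (p i x)‖ - h (p i x) =
        h (p i x) / ‖h (p i x)‖ * ((1 - ‖h (p i x)‖ : ℝ) : ℂ) := by
      push_cast
      field_simp
    rw [this, norm_mul, norm_div, Complex.norm_real, Complex.norm_real, norm_norm,
      div_self (by simpa using h0), one_mul, Real.norm_eq_abs, abs_sub_comm]
  have h3 : |‖h (p i x)‖ - 1| ≤ ‖h (p i x) - g x‖ := by
    have := abs_norm_sub_norm_le (h (p i x)) (g x : ℂ)
    rwa [Circle.norm_coe] at this
  calc ‖h (p i x) / ‖h (p i x)‖ - g x‖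
      = ‖(h (p i x) / ‖h (p i x)‖ - h (p i x)) + (h (p i x) - g x)‖ := by rw [sub_add_sub_cancel]
    _ ≤ _ := norm_add_le _ _
    _ < 1 := by linarith

/-- A real lift of `g ∘ p i` is approximated within 1 by a function from some stage. At a common
stage the exponential of its real part is liftable and at distance less than 1 from `g`, since `|exp
(it) - 1| ≤ |t|`. -/
theorem exists_map_eq_zero [∀ i, CompactSpace (K i)] [∀ i, T2Space (K i)]
    (hX : IsInverseLimit r p) (hp : ∀ i, Function.Surjective (p i)) {i : ι} {y : Bruschlinsky (K i)}
    (hy : Bruschlinsky.map (p i) y = 0) : ∃ j, ∃ h : i ≤ j, Bruschlinsky.map (r i j h) y = 0 := by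
  obtain ⟨g, rfl⟩ := Bruschlinsky.mk_surjective y
  have : Nonempty ι := ⟨i⟩
  rw [Bruschlinsky.map_mk, Bruschlinsky.mk_eq_zero] at hy
  obtain ⟨f, hf⟩ := hy
  obtain ⟨j, h, hh⟩ := hX.exists_approx ⟨fun x => (f x : ℂ), by fun_prop⟩ one_pos
  refine ⟨max i j, le_max_left i j, ?_⟩
  rw [Bruschlinsky.map_mk, Bruschlinsky.mk_eq_zero]
  let k : C(K (max i j), ℝ) := ⟨fun y => (h (r j (max i j) (le_max_right _ _) y)).re, by fun_prop⟩
  let e : C(K (max i j), Circle) := ⟨fun y => Circle.exp (k y), by fun_prop⟩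
  have he : e ∈ liftableMaps (K (max i j)) := ⟨k, fun _ => rfl⟩
  refine (Subgroup.mul_mem_cancel_left _ (inv_mem he)).1
    (inv_mul_mem_liftableMaps (g := e) fun y => ?_)
  obtain ⟨x, rfl⟩ := hp _ y
  have h1 : r i (max i j) (le_max_left _ _) (p (max i j) x) = p i x :=
    DFunLike.congr_fun (hX.comp_eq (le_max_left i j)) x
  have h2 : r j (max i j) (le_max_right _ _) (p (max i j) x) = p j x :=
    DFunLike.congr_fun (hX.comp_eq (le_max_right i j)) x
  have h3 : g (p i x) = Circle.exp (f x) := (hf x).symm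
  change ‖(g (r i _ _ (p _ x)) : ℂ) - Circle.exp (h (r j _ _ (p _ x))).re‖ < 1
  rw [h1, h2, h3]
  have h4 : (Circle.exp (f x) : ℂ) - Circle.exp (h (p j x)).re =
      Circle.exp (h (p j x)).re *
        (Complex.exp (Complex.I * ((f x - (h (p j x)).re : ℝ) : ℂ)) - 1) := by
    rw [mul_sub, mul_one, Circle.coe_exp, Circle.coe_exp, ← Complex.exp_add]
    congr 2
    push_cast
    ring
  rw [h4, norm_mul, Circle.norm_coe, one_mul]
  refine (Real.norm_exp_I_mul_ofReal_sub_one_le).trans_lt ?_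
  have h5 : ‖h (p j x) - (f x : ℂ)‖ < 1 := hh x
  have h6 := Complex.abs_re_le_norm (h (p j x) - (f x : ℂ))
  rw [Complex.sub_re, Complex.ofReal_re, abs_sub_comm] at h6
  rw [Real.norm_eq_abs]
  exact h6.trans_lt h5

end IsInverseLimit

/-! ### Retractions and the class `ClassR` -/

namespace IsRetraction

variable {X Y : Type u} [TopologicalSpace X] [TopologicalSpace Y] {f : C(X, Y)}

theorem surjective (hf : IsRetraction f) : Function.Surjective f := by
  obtain ⟨j, hj⟩ := hf
  exact fun y => ⟨j y, DFunLike.congr_fun hj y⟩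

theorem exists_map_leftInverse (hf : IsRetraction f) :
    ∃ s : Bruschlinsky X →+ Bruschlinsky Y, ∀ y, s (Bruschlinsky.map f y) = y := by
  obtain ⟨j, hj⟩ := hf
  refine ⟨Bruschlinsky.map j, fun y => ?_⟩
  rw [Bruschlinsky.map_map, hj, Bruschlinsky.map_id, AddMonoidHom.id_apply]

end IsRetraction

theorem ClassR.compactSpace_and_t2Space {X : Type u} [TopologicalSpace X] (hX : ClassR X) :
    CompactSpace X ∧ T2Space X := by
  induction hX with
  | of_metrizable X => exact ⟨inferInstance, inferInstance⟩
  | of_limit K r hr hK X p hX ih =>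
    have := fun i => (ih i).1
    have := fun i => (ih i).2
    exact ⟨hX.compactSpace, hX.t2Space⟩

/-- This serves the limit of the empty sequence, which is a single point. -/
theorem Bruschlinsky.subsingleton (X : Type u) [TopologicalSpace X] [Subsingleton X] :
    Subsingleton (Bruschlinsky X) := by
  have : DiscreteTopology X := Subsingleton.discreteTopology
  refine ⟨fun x y => ?_⟩
  obtain ⟨g, rfl⟩ := Bruschlinsky.mk_surjective x
  obtain ⟨h, rfl⟩ := Bruschlinsky.mk_surjective y
  exact Bruschlinsky.mk_eq_mk.2 ⟨⟨fun x => Complex.arg ((g⁻¹ * h) x),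
    continuous_of_discreteTopology⟩, fun x => Circle.exp_arg _⟩

theorem IsRetractiveSequence.isDirectSumOfCountable {ι : Type u} [LinearOrder ι] [WellFoundedLT ι]
    {K : ι → Type u} [∀ i, TopologicalSpace (K i)] [∀ i, CompactSpace (K i)] [∀ i, T2Space (K i)]
    {r : ∀ i j, i ≤ j → C(K j, K i)} (hr : IsRetractiveSequence r)
    {X : Type u} [TopologicalSpace X] {p : ∀ i, C(X, K i)} (hX : IsInverseLimit r p)
    (hK : ∀ i, IsDirectSumOfCountable (Bruschlinsky (K i))) :
    IsDirectSumOfCountable (Bruschlinsky X) := by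
  have hp : ∀ i, Function.Surjective (p i) :=
    hX.surjective hr.map_comp fun i j h => (hr.isRetraction i j h).surjective
  -- A class that dies in the limit dies at a later stage, but bonding retractions induce
  -- injections.
  have hinj : ∀ i, Function.Injective (Bruschlinsky.map (p i)) := by
    intro i
    rw [injective_iff_map_eq_zero]
    intro y hy
    obtain ⟨j, hij, h⟩ := hX.exists_map_eq_zero hp hy
    obtain ⟨s, hs⟩ := (hr.isRetraction i j hij).exists_map_leftInverse
    rw [← hs y, h, map_zero]
  have hmap : ∀ {i j} (h : i ≤ j) y,
      Bruschlinsky.map (p j) (Bruschlinsky.map (r i j h) y) = Bruschlinsky.map (p i) y :=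
    fun h y => by rw [Bruschlinsky.map_map, hX.comp_eq]
  let e : ∀ i, Bruschlinsky (K i) ≃+ (Bruschlinsky.map (p i)).range := fun i =>
    AddMonoidHom.ofInjective (hinj i)
  refine .of_filtration (fun i => (Bruschlinsky.map (p i)).range) ?_ ?_ ?_
    fun i => .of_addEquiv (e i).symm (hK i)
  · intro x hx
    have : Nonempty ι := by
      by_contra h
      rw [not_nonempty_iff] at h
      have : Subsingleton X := ⟨fun a b => hX.isEmbedding.injective (Subsingleton.elim _ _)⟩
      have := Bruschlinsky.subsingleton X
      exact hx (Subsingleton.elim _ _)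
    exact hX.exists_map_eq hp x
  · rintro i j hij _ ⟨y, rfl⟩
    exact ⟨Bruschlinsky.map (r i j hij) y, hmap hij y⟩
  · intro i
    by_cases hmin : IsMin i
    · exact ⟨0, fun x hx => (hx rfl).elim, fun x j hj => (hmin.not_lt hj).elim⟩
    by_cases hlim : Order.IsSuccPrelimit i
    -- At a limit index the term is already the union of the earlier ones, by continuity of the
    -- sequence, so the inclusion serves as `π`.
    · refine ⟨AddSubgroup.subtype _, ?_, fun _ _ _ _ => rfl⟩
      rintro ⟨_, y, rfl⟩ -
      have : Nonempty (Set.Iio i) := by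
        obtain ⟨j, hj⟩ := not_isMin_iff.1 hmin
        exact ⟨⟨j, hj⟩⟩
      obtain ⟨j, z, rfl⟩ := (hr.continuous i ⟨hmin, hlim⟩).exists_map_eq
        (fun j => (hr.isRetraction j i (le_of_lt j.2)).surjective) y
      exact ⟨j, j.2, z, (hmap (le_of_lt j.2) z).symm⟩
    · obtain ⟨j, hj⟩ : ∃ j, j ⋖ i := by simpa [Order.IsSuccPrelimit] using hlim
      obtain ⟨s, hs⟩ := (hr.isRetraction j i hj.le).exists_map_leftInverse
      -- At a successor of `j`, a section of the bonding map induces the projection onto the term at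
      -- `j`.
      refine ⟨((Bruschlinsky.map (p j)).comp s).comp (e i).symm.toAddMonoidHom,
        fun x _ => ⟨j, hj.lt, _, rfl⟩, ?_⟩
      rintro x l hl ⟨y, hy⟩
      have hlj : l ≤ j := not_lt.1 fun h => hj.2 h hl
      have hx : x = e i (Bruschlinsky.map (r j i hj.le) (Bruschlinsky.map (r l j hlj) y)) :=
        Subtype.ext (by
          rw [← hy, ← hmap hlj y, ← hmap hj.le]
          rfl)
      change Bruschlinsky.map (p j) (s ((e i).symm x)) = x
      rw [hx, AddEquiv.symm_apply_apply, hs]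
      exact (hmap hj.le _).symm

theorem ClassR.isDirectSumOfCountable {X : Type u} [TopologicalSpace X] (hX : ClassR X) :
    IsDirectSumOfCountable (Bruschlinsky X) := by
  induction hX with
  | of_metrizable X =>
    have := Bruschlinsky.countable X
    exact .of_countable _
  | of_limit K r hr hK X p hX ih =>
    have := fun i => (hK i).compactSpace_and_t2Space.1
    have := fun i => (hK i).compactSpace_and_t2Space.2
    exact hr.isDirectSumOfCountable hX ih

/-! ### Čech cohomology in degree one as the Bruschlinsky group -/

namespace Cech.Cover

variable {X : Type u} [TopologicalSpace X]

/-- The cocycle `c` is the obstruction to gluing local logarithms of `g` on the members of `U`. -/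
def Realizes (U : Cover X) (c : U.Z1) (g : C(X, Circle)) : Prop :=
  ∃ f : U.sets → X → ℝ, (∀ a : U.sets, ContinuousOn (f a) a) ∧
    (∀ a : U.sets, ∀ x ∈ (a : Set X), Circle.exp (f a x) = g x) ∧
    ∀ (a b : U.sets) (x : X) (ha : x ∈ (a : Set X)) (hb : x ∈ (b : Set X)),
      f b x - f a x = 2 * Real.pi * c.1 (edge a b ⟨x, ha, hb⟩)

theorem exists_mem (U : Cover X) (x : X) : ∃ a : U.sets, x ∈ (a : Set X) := by
  obtain ⟨a, ha, hx⟩ := Set.mem_sUnion.1 (U.sUnion_eq.symm ▸ Set.mem_univ x)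
  exact ⟨⟨a, ha⟩, hx⟩

/-- Functions on the members of a cover that agree on overlaps glue to a continuous function. -/
theorem exists_glue {Y : Type*} [TopologicalSpace Y] (U : Cover X) (f : U.sets → X → Y)
    (hf : ∀ a : U.sets, ContinuousOn (f a) a)
    (h : ∀ (a b : U.sets) (x : X), x ∈ (a : Set X) → x ∈ (b : Set X) → f a x = f b x) :
    ∃ F : C(X, Y), ∀ (a : U.sets), ∀ x ∈ (a : Set X), F x = f a x := by
  choose a ha using U.exists_mem
  refine ⟨⟨fun x => f (a x) x, continuous_iff_continuousAt.2 fun x => ?_⟩,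
    fun b x hb => h _ _ x (ha x) hb⟩
  have hnhds := (U.isOpen _ (a x).2).mem_nhds (ha x)
  refine ((hf (a x)).continuousAt hnhds).congr ?_
  filter_upwards [hnhds] with y hy
  exact h _ _ y hy (ha y)

namespace Realizes

variable {U V : Cover X} {c c' : U.Z1} {g g' : C(X, Circle)}

theorem add (h : U.Realizes c g) (h' : U.Realizes c' g') : U.Realizes (c + c') (g * g') := by
  obtain ⟨f, hf, hg, hc⟩ := h
  obtain ⟨f', hf', hg', hc'⟩ := h'
  refine ⟨fun a => f a + f' a, fun a => (hf a).add (hf' a), fun a x hx => ?_,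
    fun a b x ha hb => ?_⟩
  · beta_reduce
    rw [Pi.add_apply, Circle.exp_add, hg a x hx, hg' a x hx]
    rfl
  · have h1 := hc a b x ha hb
    have h2 := hc' a b x ha hb
    simp only [Pi.add_apply, AddSubgroup.coe_add, Int.cast_add]
    linarith

theorem neg (h : U.Realizes c g) : U.Realizes (-c) g⁻¹ := by
  obtain ⟨f, hf, hg, hc⟩ := h
  refine ⟨fun a => -f a, fun a => (hf a).neg, fun a x hx => ?_, fun a b x ha hb => ?_⟩
  · beta_reduce
    rw [Pi.neg_apply, Circle.exp_neg, hg a x hx]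
    rfl
  · have h1 := hc a b x ha hb
    simp only [Pi.neg_apply, AddSubgroup.coe_neg, Int.cast_neg]
    linarith

/-- Subtracting `2π t a` from the logarithm on `a` makes the local logarithms agree on overlaps, so
they glue. -/
theorem mem_liftableMaps {t : U.sets → ℤ} (h : U.Realizes (δ U t) g) : g ∈ liftableMaps X := by
  obtain ⟨f, hf, hg, hc⟩ := h
  obtain ⟨F, hF⟩ := U.exists_glue (fun a x => f a x - 2 * Real.pi * t a)
    (fun a => (hf a).sub continuousOn_const) fun a b x ha hb => by
      have : f b x - f a x = 2 * Real.pi * ((t b - t a : ℤ) : ℝ) := hc a b x ha hb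
      push_cast at this
      linarith
  refine ⟨F, fun x => ?_⟩
  obtain ⟨a, ha⟩ := U.exists_mem x
  rw [hF a x ha, Circle.exp_sub, hg a x ha, Circle.exp_two_pi_mul_int, div_one]

theorem mk_eq_mk (h : U.Realizes c g) (h' : U.Realizes c g') :
    Bruschlinsky.mk g = Bruschlinsky.mk g' := by
  refine Bruschlinsky.mk_eq_mk.2 (mem_liftableMaps (U := U) (t := 0) ?_)
  have := h.neg.add h'
  rwa [neg_add_cancel, ← map_zero (δ U)] at this

theorem pull (h : U.Realizes c g) (φ : V.sets → U.sets)
    (hφ : ∀ v : V.sets, (v : Set X) ⊆ φ v) : V.Realizes (pullZ1 φ hφ c) g := by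
  obtain ⟨f, hf, hg, hc⟩ := h
  exact ⟨fun v => f (φ v), fun v => (hf _).mono (hφ v), fun v x hx => hg _ x (hφ v hx),
    fun a b x ha hb => hc _ _ x (hφ a ha) (hφ b hb)⟩

theorem exists_res_eq_zero (h : U.Realizes c g) (hg : g ∈ liftableMaps X) :
    ∃ V, ∃ hUV : U ≤ V, res U V hUV (QuotientAddGroup.mk c) = 0 := by
  obtain ⟨f, hf, hfg, hc⟩ := h
  obtain ⟨F, hF⟩ := hg
  have hpi := Real.pi_pos
  have hint : ∀ (a : U.sets), ∀ x ∈ (a : Set X), ∃ n : ℤ, f a x - F x = 2 * Real.pi * n := by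
    intro a x hx
    obtain ⟨n, hn⟩ := Circle.exp_eq_exp.1 ((hfg a x hx).trans (hF x).symm)
    exact ⟨n, by rw [hn]; ring⟩
  -- `W a n` is the part of `a` where `f a - F` equals `2πn`. The ball shows that it is open and
  -- contains no other multiple of `2π`; on these sets the cocycle is the coboundary of `n`.
  let W : U.sets → ℤ → Set X := fun a n =>
    a ∩ (fun x => f a x - F x) ⁻¹' Metric.ball (2 * Real.pi * n) (2 * Real.pi)
  have hW : ∀ a n, ∀ x ∈ W a n, f a x - F x = 2 * Real.pi * n := by
    rintro a n x ⟨hx, hxn⟩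
    obtain ⟨m, hm⟩ := hint a x hx
    rw [Set.mem_preimage, hm, Metric.mem_ball, Real.dist_eq, ← mul_sub, abs_mul,
      abs_of_pos (by positivity), mul_lt_iff_lt_one_right (by positivity)] at hxn
    have : |m - n| < 1 := by exact_mod_cast hxn
    rw [Int.abs_lt_one_iff, sub_eq_zero] at this
    rw [hm, this]
  let V : Cover X :=
    { sets := {w | ∃ a n, w = W a n}
      isOpen := by
        rintro _ ⟨a, n, rfl⟩
        exact ((hf a).sub F.continuous.continuousOn).isOpen_inter_preimage (U.isOpen a a.2)
          Metric.isOpen_ball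
      sUnion_eq := Set.eq_univ_of_forall fun x => by
        obtain ⟨a, ha⟩ := U.exists_mem x
        obtain ⟨n, hn⟩ := hint a x ha
        refine ⟨W a n, ⟨a, n, rfl⟩, ha, ?_⟩
        rw [Set.mem_preimage, hn]
        exact Metric.mem_ball_self (by positivity) }
  -- One set may equal `W a n` for several pairs, so a pair is fixed for each.
  choose φ n hφn using fun v : V.sets => v.2
  have hφ : ∀ v : V.sets, (v : Set X) ⊆ φ v := fun v => by
    rw [hφn v]
    exact Set.inter_subset_left
  refine ⟨V, fun v hv => ⟨_, (φ ⟨v, hv⟩).2, hφ ⟨v, hv⟩⟩, ?_⟩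
  rw [res, pullH1_eq _ φ _ hφ]
  refine (QuotientAddGroup.eq_zero_iff (N := (δ V).range) (pullZ1 φ hφ c)).2 ⟨n, ?_⟩
  ext ⟨⟨a, b⟩, x, ha, hb⟩
  have h1 := hc (φ a) (φ b) x (hφ a ha) (hφ b hb)
  have h2 := hW _ _ x (hφn a ▸ ha)
  have h3 := hW _ _ x (hφn b ▸ hb)
  have h4 : 2 * Real.pi * ((n b - n a : ℤ) : ℝ) =
      2 * Real.pi * c.1 (edge (φ a) (φ b) ⟨x, hφ a ha, hφ b hb⟩) := by
    push_cast
    linarith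
  exact_mod_cast mul_left_cancel₀ (by positivity) h4

end Realizes

/-- A partition of unity makes `2πc` the coboundary of the real functions `f a = 2π ∑ ρ_d c(d, a)`,
by the cocycle identity. Their exponentials agree on overlaps because `c` is integral. -/
theorem exists_realizes [CompactSpace X] [T2Space X] (U : Cover X) (c : U.Z1) :
    ∃ g, U.Realizes c g := by
  classical
  obtain ⟨ρ, hρ⟩ := PartitionOfUnity.exists_isSubordinate (s := Set.univ) isClosed_univ
    (fun a : U.sets => (a : Set X)) (fun a => U.isOpen a a.2) fun x _ =>
      Set.mem_iUnion.2 (U.exists_mem x)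
  -- The default 0 is harmless: if `ρ d` is nonzero at a point of `a`, then `d` meets `a`.
  let k : U.sets → U.sets → ℝ := fun d a =>
    if h : ((d : Set X) ∩ a).Nonempty then (c.1 (edge d a h) : ℝ) else 0
  let f : U.sets → X → ℝ := fun a x => 2 * Real.pi * ∑ᶠ d, ρ d x • k d a
  have hf : ∀ a, Continuous (f a) := fun a =>
    continuous_const.mul (ρ.continuous_finsum_smul fun d x _ => continuousAt_const)
  have hdiff : ∀ (a b : U.sets) (x : X) (ha : x ∈ (a : Set X)) (hb : x ∈ (b : Set X)),
      f b x - f a x = 2 * Real.pi * c.1 (edge a b ⟨x, ha, hb⟩) := by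
    intro a b x ha hb
    change 2 * Real.pi * _ - 2 * Real.pi * _ = _
    rw [← mul_sub, ← ρ.sum_finsupport_smul_eq_finsum (fun d _ => k d b),
      ← ρ.sum_finsupport_smul_eq_finsum (fun d _ => k d a), ← Finset.sum_sub_distrib]
    congr 1
    rw [← one_mul (c.1 _ : ℝ), ← ρ.sum_finsupport (Set.mem_univ x), Finset.sum_mul]
    refine Finset.sum_congr rfl fun d hd => ?_
    have hdx : x ∈ (d : Set X) := hρ d (subset_tsupport _ ((ρ.mem_finsupport x).1 hd))
    have hcoc := c.2 d a b ⟨x, ⟨hdx, ha⟩, hb⟩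
    rw [← smul_sub, smul_eq_mul]
    congr 1
    simp only [k]
    rw [dif_pos ⟨x, hdx, hb⟩, dif_pos ⟨x, hdx, ha⟩, ← Int.cast_sub]
    congr 1
    linarith
  obtain ⟨g, hg⟩ := U.exists_glue (fun a x => Circle.exp (f a x))
    (fun a => (Circle.exp.continuous.comp (hf a)).continuousOn) fun a b x ha hb => by
      rw [← sub_add_cancel (f b x) (f a x), hdiff a b x ha hb, Circle.exp_add,
        Circle.exp_two_pi_mul_int, one_mul]
  exact ⟨g, f, fun a => (hf a).continuousOn, fun a x hx => (hg a x hx).symm, hdiff⟩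

theorem exists_cover_realizes (g : C(X, Circle)) : ∃ (U : Cover X) (c : U.Z1), U.Realizes c g := by
  have hpi := Real.pi_pos
  -- Oscillation below `π` on each member makes the difference of two logarithms oscillate by less
  -- than `2π` on an overlap. Lying in `2πℤ`, it is constant there even if the overlap is
  -- disconnected.
  let U : Cover X :=
    { sets := {a | IsOpen a ∧ ∃ f : X → ℝ, ContinuousOn f a ∧
        (∀ x ∈ a, Circle.exp (f x) = g x) ∧ ∀ x ∈ a, ∀ y ∈ a, |f x - f y| < Real.pi}
      isOpen := fun a ha => ha.1
      sUnion_eq := Set.eq_univ_of_forall fun z => by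
        let q : X → ℂ := fun x => (g x / g z : Circle)
        have hq : Continuous q := by fun_prop
        let s : Set ℂ := Complex.slitPlane ∩ {w | |Complex.arg w| < Real.pi / 2}
        have hs : IsOpen s :=
          ContinuousOn.isOpen_inter_preimage (f := fun w => |Complex.arg w|)
            (fun w hw => (Complex.continuousAt_arg hw).abs.continuousWithinAt)
            Complex.isOpen_slitPlane isOpen_Iio
        refine ⟨q ⁻¹' s, ⟨hs.preimage hq, fun x => Complex.arg (q x) + Complex.arg (g z),
          fun x hx => ?_, fun x hx => ?_, fun x hx y hy => ?_⟩, ?_⟩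
        · exact (((Complex.continuousAt_arg hx.1).comp hq.continuousAt).add
            continuousAt_const).continuousWithinAt
        · rw [Circle.exp_add, Circle.exp_arg, Circle.exp_arg, div_mul_cancel]
        · have h1 := abs_lt.1 (show |Complex.arg (q x)| < Real.pi / 2 from hx.2)
          have h2 := abs_lt.1 (show |Complex.arg (q y)| < Real.pi / 2 from hy.2)
          rw [abs_lt]
          constructor <;> linarith [h1.1, h1.2, h2.1, h2.2]
        · have : q z = 1 := by simp [q]
          rw [Set.mem_preimage, this]
          exact ⟨Complex.one_mem_slitPlane, by simp⟩ }
  choose f hf hfg hosc using fun a : U.sets => a.2.2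
  have hint : ∀ (a b : U.sets) (x : X), x ∈ (a : Set X) → x ∈ (b : Set X) →
      ∃ n : ℤ, f b x - f a x = 2 * Real.pi * n := by
    intro a b x ha hb
    obtain ⟨n, hn⟩ := Circle.exp_eq_exp.1 ((hfg b x hb).trans (hfg a x ha).symm)
    exact ⟨n, by rw [hn]; ring⟩
  have hedge : ∀ e : U.Edge, ∃ n : ℤ, ∀ x, x ∈ (e.1.1 : Set X) → x ∈ (e.1.2 : Set X) →
      f e.1.2 x - f e.1.1 x = 2 * Real.pi * n := by
    rintro ⟨⟨a, b⟩, x, ha, hb⟩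
    obtain ⟨n, hn⟩ := hint a b x ha hb
    refine ⟨n, fun y hya hyb => ?_⟩
    obtain ⟨m, hm⟩ := hint a b y hya hyb
    have h1 := abs_lt.1 (hosc a x ha y hya)
    have h2 := abs_lt.1 (hosc b x hb y hyb)
    have h3 : |2 * Real.pi * ((n : ℝ) - m)| < 2 * Real.pi := by
      rw [mul_sub, ← hn, ← hm, abs_lt]
      constructor <;> linarith [h1.1, h1.2, h2.1, h2.2]
    rw [abs_mul, abs_of_pos (by positivity), mul_lt_iff_lt_one_right (by positivity)] at h3
    have h4 : |n - m| < 1 := by exact_mod_cast h3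
    rw [Int.abs_lt_one_iff, sub_eq_zero] at h4
    rw [h4]
    exact hm
  choose c hc using hedge
  refine ⟨U, ⟨c, fun a b d ⟨x, ⟨ha, hb⟩, hd⟩ => ?_⟩, f, hf, hfg,
    fun a b x ha hb => hc (edge a b ⟨x, ha, hb⟩) x ha hb⟩
  have h1 := hc (edge a b ⟨x, ha, hb⟩) x ha hb
  have h2 := hc (edge b d ⟨x, hb, hd⟩) x hb hd
  have h3 := hc (edge a d ⟨x, ha, hd⟩) x ha hd
  simp only [edge] at h1 h2 h3 ⊢
  have h4 : 2 * Real.pi * ((c (edge b d ⟨x, hb, hd⟩) - c (edge a d ⟨x, ha, hd⟩) +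
      c (edge a b ⟨x, ha, hb⟩) : ℤ) : ℝ) = 2 * Real.pi * ((0 : ℤ) : ℝ) := by
    push_cast
    simp only [edge]
    linarith
  exact_mod_cast mul_left_cancel₀ (by positivity) h4

variable [CompactSpace X] [T2Space X]

/-- The class of a map to the circle realizing a given cocycle. -/
noncomputable def classOfCocycle (U : Cover X) : U.Z1 →+ Bruschlinsky X :=
  AddMonoidHom.mk' (fun c => Bruschlinsky.mk (U.exists_realizes c).choose) fun c c' => by
    rw [← Bruschlinsky.mk_mul]
    exact (U.exists_realizes _).choose_spec.mk_eq_mk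
      ((U.exists_realizes c).choose_spec.add (U.exists_realizes c').choose_spec)

theorem Realizes.classOfCocycle_eq {U : Cover X} {c : U.Z1} {g : C(X, Circle)}
    (h : U.Realizes c g) : U.classOfCocycle c = Bruschlinsky.mk g :=
  (U.exists_realizes c).choose_spec.mk_eq_mk h

/-- The map from the cohomology of the nerve of a cover to the Bruschlinsky group. -/
noncomputable def toBruschlinsky (U : Cover X) : U.H1 →+ Bruschlinsky X :=
  QuotientAddGroup.lift _ U.classOfCocycle (by
    rintro _ ⟨t, rfl⟩
    exact Bruschlinsky.mk_eq_zero.2 (U.exists_realizes _).choose_spec.mem_liftableMaps)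

theorem toBruschlinsky_res (U V : Cover X) (h : U ≤ V) (x : U.H1) :
    V.toBruschlinsky (res U V h x) = U.toBruschlinsky x := by
  obtain ⟨c, rfl⟩ := QuotientAddGroup.mk_surjective x
  exact ((U.exists_realizes c).choose_spec.pull _ _).classOfCocycle_eq

end Cech.Cover

/-- Čech cohomology in degree one of a compact Hausdorff space is its Bruschlinsky group. -/
theorem Cech.nonempty_addEquiv_bruschlinsky (X : Type u) [TopologicalSpace X] [CompactSpace X]
    [T2Space X] : Nonempty (Cech.H1 X ≃+ Bruschlinsky X) := by
  classical
  let Φ : Cech.H1 X →+ Bruschlinsky X :=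
    AddCommGroup.DirectLimit.lift _ _ _ Cover.toBruschlinsky Cover.toBruschlinsky_res
  have hΦ : ∀ (U : Cover X) (c : U.Z1), Φ (AddCommGroup.DirectLimit.of _ _ U
      (QuotientAddGroup.mk c)) = U.classOfCocycle c := fun U c =>
    AddCommGroup.DirectLimit.lift_of _ _ _ _ _
  refine ⟨AddEquiv.ofBijective Φ ⟨(injective_iff_map_eq_zero Φ).2 fun z hz => ?_, fun y => ?_⟩⟩
  · induction z using AddCommGroup.DirectLimit.induction_on with
    | ih U x =>
      obtain ⟨c, rfl⟩ := QuotientAddGroup.mk_surjective x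
      obtain ⟨g, hg⟩ := U.exists_realizes c
      rw [hΦ, hg.classOfCocycle_eq, Bruschlinsky.mk_eq_zero] at hz
      obtain ⟨V, hUV, h⟩ := hg.exists_res_eq_zero hz
      exact (AddCommGroup.DirectLimit.of_f hUV _).symm.trans ((congrArg _ h).trans (map_zero _))
  · obtain ⟨g, rfl⟩ := Bruschlinsky.mk_surjective y
    obtain ⟨U, c, hg⟩ := Cover.exists_cover_realizes g
    exact ⟨_, (hΦ U c).trans hg.classOfCocycle_eq⟩

theorem theorem1 (X : Type u) [TopologicalSpace X] [CompactSpace X] [T2Space X]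
    (Y : Type u) [TopologicalSpace Y] (hY : ClassR Y)
    (f : C(Y, X)) (hf : IsRetraction f) :
    ∃ (I : Type u) (A : I → Type u) (_ : ∀ i, AddCommGroup (A i)),
      (∀ i, Countable (A i)) ∧ Nonempty (Cech.H1 X ≃+ ⨁ i, A i) := by
  obtain ⟨φ⟩ := Cech.nonempty_addEquiv_bruschlinsky X
  obtain ⟨s, hs⟩ := hf.exists_map_leftInverse
  -- The group of `X` is a direct summand of that of `Y`.
  exact IsDirectSumOfCountable.of_addEquiv φ (hY.isDirectSumOfCountable.of_retract (Bruschlinsky.map f) s hs)
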